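/- For a simple graph $G$, its $2$-token graph $F_2(G)$ has as vertices the $2$-element subsets of $V(G)$, two of them $A,B$ being adjacent when $A\bigtriangleup B=\{a,b\}$ with $a\in A$, $b\in B$ and $\{a,b\}\in E(G)$. For a finite non-empty graph $H$, let $\rho(H)$ be its spectral radius, that is, the largest eigenvalue of its adjacency matrix; for an infinite graph $H$ of bounded degree, let $\rho(H)$ be the spectral radius of its adjacency operator $(Tf)(v)=\sum_{w\sim v}f(w)$ on $\ell^2(V(H))$. Let $P_n$ and $C_n$ be the path and the cycle on $n$ vertices, $K_{n,n}$ the complete bipartite graph with both parts of size $n$, $P_\infty$ the infinite path with vertex set $\{0,1,2,\dots\}$, and $C_\infty$ the infinite cycle with vertex set $\mathbb Z$, where in both infinite graphs two integers are adjacent when they differ by $1$. Then: (i) $\rho(F_2(P_n))\le 4\cos(\pi/n)$ for every $n\ge 2$; moreover $\rho(F_2(P_\infty))=4$ and $\lim_{n\to\infty}\rho(F_2(P_n))=4$. (ii) $\rho(F_2(C_n))=4\cos(\pi/n)$ for every $n\ge 3$; moreover $\rho(F_2(C_\infty))=4$ and $\lim_{n\to\infty}\rho(F_2(C_n))=4$.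 (iii) $\rho(F_2(K_{n,n}))=2\sqrt{n(n-1)}$ for every $n\ge 1$. -/

import Mathlib

open scoped Topology NNReal ENNReal

namespace TokenGraph

/-- The `k`-element subsets of `V`, i.e. the vertices of the `k`-token graph. -/
abbrev Vertex (V : Type*) (k : ℕ) : Type _ := {A : Finset V // A.card = k}

/-- The `k`-token graph (symmetric `k`-th power) `F_k(G)`: two `k`-subsets `A`, `B` are adjacent
when `A ∆ B = {a, b}` with `a ∈ A`, `b ∈ B` and `ab` an edge of `G`. -/
def tokenGraph {V : Type*} [DecidableEq V] (k : ℕ) (G : SimpleGraph V) :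
    SimpleGraph (Vertex V k) where
  Adj A B := ∃ a b, a ∈ A.1 ∧ b ∈ B.1 ∧ G.Adj a b ∧ symmDiff A.1 B.1 = {a, b}
  symm := ⟨by
    rintro A B ⟨a, b, ha, hb, hab, h⟩
    exact ⟨b, a, hb, ha, hab.symm, by rw [symmDiff_comm, h, Finset.pair_comm]⟩⟩
  loopless := ⟨by
    rintro A ⟨a, b, -, -, -, h⟩
    rw [symmDiff_self] at h
    exact Finset.insert_ne_empty a {b} h.symm⟩

open Classical in
/-- The spectral radius (index) of a finite graph: the largest eigenvalue of its real adjacency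
matrix. The supremum is a maximum as soon as the graph has a vertex. -/
noncomputable def index {V : Type*} [Fintype V] (G : SimpleGraph V) : ℝ :=
  sSup {μ : ℝ | Module.End.HasEigenvalue (Matrix.toLin' (G.adjMatrix ℝ)) μ}

/-- `T` is the adjacency operator of `G` on `ℓ²(V)`: `(T f)(v) = ∑_{w ∼ v} f(w)`.
There is at most one such bounded operator. -/
def IsAdjOperator {V : Type*} (G : SimpleGraph V)
    (T : lp (fun _ : V => ℂ) 2 →L[ℂ] lp (fun _ : V => ℂ) 2) : Prop :=
  ∀ (f : lp (fun _ : V => ℂ) 2) (v : V), HasSum (fun w : G.neighborSet v => f w.1) (T f v)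

/-- The (possibly infinite) graph `G` has spectral radius `r`: its adjacency operator is a bounded
operator on `ℓ²(V)` whose spectral radius is `r`. -/
def HasSpectralRadius {V : Type*} (G : SimpleGraph V) (r : ℝ≥0) : Prop :=
  ∃ T : lp (fun _ : V => ℂ) 2 →L[ℂ] lp (fun _ : V => ℂ) 2,
    IsAdjOperator G T ∧ spectralRadius ℂ T = (r : ℝ≥0∞)

/-- The infinite path `0 - 1 - 2 - ⋯`. -/
def infinitePathGraph : SimpleGraph ℕ := SimpleGraph.hasse ℕ

/-- The infinite cycle: `i` and `j` in `ℤ` are adjacent when they differ by one. -/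
def infiniteCycleGraph : SimpleGraph ℤ := SimpleGraph.circulantGraph {1}

end TokenGraph

/-!
A symmetric function `g` of two vertices that vanishes on the diagonal is a function on the
vertices of `F₂(G)`, and the adjacency operator of `F₂(G)` acts on it as that of `G` applied to
each of the two variables separately: the forbidden move of one token onto the other contributes
a diagonal value, that is, zero (`sum_adj_pairFun`). Positive eigenfunctions on `F₂(G)` can
therefore be written down in terms of the two variables, and a positive eigenfunction belongs to
the index, while a positive `f` with `A f ≤ c f` gives the upper bound `c`
(`index_eq_of_sum_eq`, `index_le_of_sum_le`).

* On `Cₙ` the function `|sin (π (i - j) / n)|` is a positive eigenfunction for `4 cos (π / n)`.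
  On `Pₙ` some neighbours are missing, which leaves an inequality.
* On `Pₙ` the Slater determinant of the two leading one-particle eigenfunctions, made symmetric, is
  a positive eigenfunction, because tokens on a path cannot pass each other. Hence the index of
  `F₂(Pₙ)` is exactly `2 cos (π / (n + 1)) + 2 cos (2π / (n + 1))`, which tends to `4`.
* On `K_{n,n}` the partition of the pairs into those inside a part and those meeting both parts is
  equitable, and the eigenfunction is constant on its two classes.

For the two infinite graphs the degrees in `F₂` are at most `4`, so the adjacency operator exists,
is self-adjoint and has norm at most `4` (`exists_isAdjOperator`). Its spectral radius is its norm,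
and extending the eigenfunctions of the induced subgraphs `F₂(Pₙ)` by zero shows that the norm is
at least the index of each of them (`abs_eigenvalue_le_norm_of_embedding`), hence at least `4`.
-/

namespace TokenGraph

/-! ### Two tokens -/

section TwoTokens

variable {V : Type*} [DecidableEq V] {G : SimpleGraph V}

/-- Moving one token: the neighbours of `{x, y}` in the `2`-token graph arise by moving the token
at `x` or the token at `y` along an edge to an unoccupied vertex. -/
theorem adj_tokenGraph_two_iff {x y : V} (hxy : x ≠ y) {A B : Vertex V 2} (hA : A.1 = {x, y}) :
    (tokenGraph 2 G).Adj A B ↔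
      (∃ x', G.Adj x x' ∧ x' ≠ y ∧ B.1 = {x', y}) ∨
        (∃ y', G.Adj y y' ∧ y' ≠ x ∧ B.1 = {x, y'}) := by
  constructor
  · rintro ⟨a, b, ha, hb, hab, h⟩
    have hbA : b ∉ A.1 := by
      have : b ∈ symmDiff A.1 B.1 := by simp [h]
      grind [Finset.mem_symmDiff]
    have haB : a ∉ B.1 := by
      have : a ∈ symmDiff A.1 B.1 := by simp [h]
      grind [Finset.mem_symmDiff]
    have hother : ∀ z, z ≠ a → z ≠ b → (z ∈ A.1 ↔ z ∈ B.1) := by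
      intro z hza hzb
      have : z ∉ symmDiff A.1 B.1 := by simp [h, hza, hzb]
      grind [Finset.mem_symmDiff]
    rw [hA] at ha hbA hother
    simp only [Finset.mem_insert, Finset.mem_singleton, not_or] at ha hbA hother
    rcases ha with rfl | rfl
    · refine Or.inl ⟨b, hab, hbA.2, ?_⟩
      ext z
      simp only [Finset.mem_insert, Finset.mem_singleton]
      by_cases hza : z = a <;> by_cases hzb : z = b <;> grind
    · refine Or.inr ⟨b, hab, hbA.1, ?_⟩
      ext z
      simp only [Finset.mem_insert, Finset.mem_singleton]
      by_cases hza : z = a <;> by_cases hzb : z = b <;> grind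
  · rintro (⟨x', h, hne, hB⟩ | ⟨y', h, hne, hB⟩)
    · refine ⟨x, x', by simp [hA], by simp [hB], h, ?_⟩
      have := h.ne
      ext z
      simp only [hA, hB, Finset.mem_symmDiff, Finset.mem_insert, Finset.mem_singleton]
      grind
    · refine ⟨y, y', by simp [hA], by simp [hB], h, ?_⟩
      have := h.ne
      ext z
      simp only [hA, hB, Finset.mem_symmDiff, Finset.mem_insert, Finset.mem_singleton]
      grind

theorem Vertex.exists_eq_pair (A : Vertex V 2) : ∃ x y, x ≠ y ∧ A.1 = {x, y} :=
  Finset.card_eq_two.mp A.2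

/-- The function on `2`-subsets induced by a symmetric function `g` of two variables that vanishes
on the diagonal: its value at `{x, y}` is `g x y`. -/
noncomputable def pairFun (g : V → V → ℝ) (A : Vertex V 2) : ℝ :=
  (∑ x ∈ A.1, ∑ y ∈ A.1, g x y) / 2

theorem pairFun_eq {g : V → V → ℝ} (hg : ∀ x y, g x y = g y x) (hg0 : ∀ x, g x x = 0)
    {x y : V} (hxy : x ≠ y) {A : Vertex V 2} (hA : A.1 = {x, y}) : pairFun g A = g x y := by
  simp only [pairFun, hA, Finset.sum_pair hxy, hg0, hg y x]
  ring

/-- The adjacency operator of the `2`-token graph acts on a symmetric function vanishing on the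
diagonal by moving each of the two variables independently: the forbidden moves, onto the vertex
of the other token, contribute diagonal values. -/
theorem sum_adj_pairFun [Fintype V] [DecidableRel G.Adj] [DecidableRel (tokenGraph 2 G).Adj]
    {g : V → V → ℝ} (hg : ∀ x y, g x y = g y x) (hg0 : ∀ x, g x x = 0)
    {x y : V} (hxy : x ≠ y) {A : Vertex V 2} (hA : A.1 = {x, y}) :
    ∑ B with (tokenGraph 2 G).Adj A B, pairFun g B =
      (∑ x' with G.Adj x x', g x' y) + ∑ y' with G.Adj y y', g x y' := by
  classical
  have hsum : ∀ F : Finset V → ℝ, ∑ B with (tokenGraph 2 G).Adj A B, F B.1 =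
      ∑ s ∈ (Finset.univ.filter fun B => (tokenGraph 2 G).Adj A B).image Subtype.val, F s :=
    fun F => (Finset.sum_image Subtype.val_injective.injOn).symm
  have himg : (Finset.univ.filter fun B => (tokenGraph 2 G).Adj A B).image Subtype.val =
      ((Finset.univ.filter fun x' => G.Adj x x' ∧ x' ≠ y).image fun x' => ({x', y} : Finset V)) ∪
      ((Finset.univ.filter fun y' => G.Adj y y' ∧ y' ≠ x).image
        fun y' => ({x, y'} : Finset V)) := by
    ext s
    simp only [Finset.mem_image, Finset.mem_filter, Finset.mem_univ, true_and, Finset.mem_union,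
      adj_tokenGraph_two_iff hxy hA]
    constructor
    · rintro ⟨B, ⟨x', h, hne, hB⟩ | ⟨y', h, hne, hB⟩, rfl⟩
      · exact Or.inl ⟨x', ⟨h, hne⟩, hB.symm⟩
      · exact Or.inr ⟨y', ⟨h, hne⟩, hB.symm⟩
    · rintro (⟨x', ⟨h, hne⟩, rfl⟩ | ⟨y', ⟨h, hne⟩, rfl⟩)
      · exact ⟨⟨_, Finset.card_pair hne⟩, Or.inl ⟨x', h, hne, rfl⟩, rfl⟩
      · exact ⟨⟨_, Finset.card_pair hne.symm⟩, Or.inr ⟨y', h, hne, rfl⟩, rfl⟩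
  have hdisj : Disjoint
      ((Finset.univ.filter fun x' => G.Adj x x' ∧ x' ≠ y).image fun x' => ({x', y} : Finset V))
      ((Finset.univ.filter fun y' => G.Adj y y' ∧ y' ≠ x).image
        fun y' => ({x, y'} : Finset V)) := by
    rw [Finset.disjoint_left]
    intro s hs hs'
    simp only [Finset.mem_image, Finset.mem_filter, Finset.mem_univ, true_and] at hs hs'
    obtain ⟨x', ⟨h, hne⟩, rfl⟩ := hs
    obtain ⟨y', ⟨h', hne'⟩, heq⟩ := hs'
    have h1 : x ∈ ({x', y} : Finset V) := heq ▸ Finset.mem_insert_self _ _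
    simp only [Finset.mem_insert, Finset.mem_singleton] at h1
    rcases h1 with h1 | h1
    · exact h.ne h1
    · exact hxy h1
  have hleft : ∑ x' with G.Adj x x', g x' y = ∑ x' with G.Adj x x' ∧ x' ≠ y, g x' y := by
    rw [← Finset.filter_filter]
    symm
    apply Finset.sum_filter_of_ne
    rintro x' - h rfl
    exact h (hg0 _)
  have hright : ∑ y' with G.Adj y y', g x y' = ∑ y' with G.Adj y y' ∧ y' ≠ x, g x y' := by
    rw [← Finset.filter_filter]
    symm
    apply Finset.sum_filter_of_ne
    rintro x' - h rfl
    exact h (hg0 _)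
  have hpair : ∀ a b, a ≠ b →
      (∑ x ∈ ({a, b} : Finset V), ∑ y ∈ ({a, b} : Finset V), g x y) / 2 = g a b := fun a b hab => by
    simp only [Finset.sum_pair hab, hg0, hg b a]
    ring
  rw [hleft, hright]
  refine (hsum fun s => (∑ x ∈ s, ∑ y ∈ s, g x y) / 2).trans ?_
  rw [himg, Finset.sum_union hdisj, Finset.sum_image, Finset.sum_image]
  · congr 1
    · refine Finset.sum_congr rfl fun x' hx' => hpair _ _ ?_
      exact (Finset.mem_filter.mp hx').2.2
    · refine Finset.sum_congr rfl fun x' hx' => hpair _ _ ?_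
      exact (Finset.mem_filter.mp hx').2.2.symm
  · intro a ha b hb hab
    have ha' := (Finset.mem_filter.mp ha).2.2
    have h1 : a ∈ ({x, b} : Finset V) := (show ({x, a} : Finset V) = {x, b} from hab) ▸ by simp
    simpa [ha'] using h1
  · intro a ha b hb hab
    have ha' := (Finset.mem_filter.mp ha).2.2
    have h1 : a ∈ ({b, y} : Finset V) := (show ({a, y} : Finset V) = {b, y} from hab) ▸ by simp
    simpa [ha'] using h1

/-- Each of the two tokens has at most `d` moves. -/
theorem encard_neighborSet_tokenGraph_two_le {d : ℕ∞} (h : ∀ v, (G.neighborSet v).encard ≤ d)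
    (A : Vertex V 2) : ((tokenGraph 2 G).neighborSet A).encard ≤ d + d := by
  obtain ⟨x, y, hxy, hA⟩ := A.exists_eq_pair
  rw [← Subtype.val_injective.encard_image]
  have hsub : Subtype.val '' (tokenGraph 2 G).neighborSet A ⊆
      ((fun x' => ({x', y} : Finset V)) '' G.neighborSet x) ∪
        ((fun y' => ({x, y'} : Finset V)) '' G.neighborSet y) := by
    rintro _ ⟨B, hB, rfl⟩
    rcases (adj_tokenGraph_two_iff hxy hA).mp hB with ⟨x', h, -, hB⟩ | ⟨y', h, -, hB⟩
    · exact Or.inl ⟨x', h, hB.symm⟩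
    · exact Or.inr ⟨y', h, hB.symm⟩
  refine (Set.encard_le_encard hsub).trans ((Set.encard_union_le _ _).trans ?_)
  exact add_le_add ((Set.encard_image_le _ _).trans (h x)) ((Set.encard_image_le _ _).trans (h y))

/-- An embedding of `G` onto an induced subgraph of `H` induces one of token graphs. -/
def tokenGraphEmbedding {W : Type*} [DecidableEq W] {H : SimpleGraph W} (k : ℕ) (φ : G ↪g H) :
    tokenGraph k G ↪g tokenGraph k H where
  toFun A := ⟨A.1.map φ.toEmbedding, by rw [Finset.card_map, A.2]⟩
  inj' A B h := Subtype.ext (Finset.map_injective _ (congrArg Subtype.val h))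
  map_rel_iff' {A B} := by
    have hsd : symmDiff (A.1.map φ.toEmbedding) (B.1.map φ.toEmbedding) =
        (symmDiff A.1 B.1).map φ.toEmbedding := by
      simp only [Finset.map_eq_image]
      exact (Finset.image_symmDiff _ _ φ.injective).symm
    constructor
    · rintro ⟨a, b, ha, hb, hab, h⟩
      obtain ⟨a, ha', rfl⟩ := Finset.mem_map.mp ha
      obtain ⟨b, hb', rfl⟩ := Finset.mem_map.mp hb
      refine ⟨a, b, ha', hb', φ.map_rel_iff.mp hab, ?_⟩
      apply Finset.map_injective φ.toEmbedding
      rw [← hsd]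
      exact h.trans (by simp)
    · rintro ⟨a, b, ha, hb, hab, h⟩
      refine ⟨φ a, φ b, Finset.mem_map_of_mem _ ha, Finset.mem_map_of_mem _ hb,
        φ.map_rel_iff.mpr hab, ?_⟩
      change symmDiff (A.1.map φ.toEmbedding) (B.1.map φ.toEmbedding) = _
      rw [hsd, h]
      simp

end TwoTokens

/-! ### The index of a finite graph -/

section Index

variable {V : Type*} [Fintype V] {G : SimpleGraph V} [DecidableRel G.Adj]

theorem hasEigenvalue_adjMatrix_iff [DecidableEq V] {μ : ℝ} :
    Module.End.HasEigenvalue (Matrix.toLin' (G.adjMatrix ℝ)) μ ↔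
      ∃ f : V → ℝ, f ≠ 0 ∧ ∀ v, ∑ w with G.Adj v w, f w = μ * f v := by
  have key : ∀ f : V → ℝ, (Matrix.toLin' (G.adjMatrix ℝ) f = μ • f) ↔
      ∀ v, ∑ w with G.Adj v w, f w = μ * f v := fun f => by
    rw [funext_iff]
    refine forall_congr' fun v => ?_
    rw [Matrix.toLin'_apply, SimpleGraph.adjMatrix_mulVec_apply,
      SimpleGraph.neighborFinset_eq_filter]
    rfl
  constructor
  · intro h
    obtain ⟨f, hf⟩ := h.exists_hasEigenvector
    exact ⟨f, hf.2, (key f).mp hf.apply_eq_smul⟩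
  · rintro ⟨f, hf0, hf⟩
    exact Module.End.hasEigenvalue_of_hasEigenvector
      ⟨Module.End.mem_eigenspace_iff.mpr ((key f).mpr hf), hf0⟩

theorem index_eq_sSup (G : SimpleGraph V) [DecidableRel G.Adj] : index G =
    sSup {μ : ℝ | ∃ f : V → ℝ, f ≠ 0 ∧ ∀ v, ∑ w with G.Adj v w, f w = μ * f v} := by
  classical
  unfold index
  congr 1
  ext μ
  simp only [Set.mem_ofPred_eq]
  rw [← hasEigenvalue_adjMatrix_iff]
  convert Iff.rfl

/-- A positive function `f` with `A f ≤ c f` bounds all eigenvalues of `A`: compare an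
eigenfunction `u` with the smallest multiple of `f` dominating `|u|`. -/
theorem eigenvalue_le_of_sum_le {f : V → ℝ} (hf : ∀ v, 0 < f v) {c : ℝ}
    (hc : ∀ v, ∑ w with G.Adj v w, f w ≤ c * f v) {μ : ℝ} {u : V → ℝ} (hu0 : u ≠ 0)
    (hu : ∀ v, ∑ w with G.Adj v w, u w = μ * u v) : μ ≤ c := by
  obtain ⟨v₀, hv₀⟩ := Function.ne_iff.mp hu0
  have : Nonempty V := ⟨v₀⟩
  obtain ⟨m, hm⟩ := Finite.exists_max fun v => |u v| / f v
  have hle : ∀ w, |u w| ≤ |u m| / f m * f w := fun w => (div_le_iff₀ (hf w)).mp (hm w)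
  have hmpos : 0 < |u m| / f m := (div_pos (abs_pos.mpr hv₀) (hf v₀)).trans_le (hm v₀)
  have hum : 0 < |u m| := by
    rcases (abs_nonneg (u m)).lt_or_eq with h | h
    · exact h
    · rw [← h, zero_div] at hmpos
      exact absurd hmpos (lt_irrefl _)
  have h1 : μ * |u m| ≤ c * |u m| := calc
    μ * |u m| ≤ |μ| * |u m| := by gcongr; exact le_abs_self μ
    _ = |∑ w with G.Adj m w, u w| := by rw [hu m, abs_mul]
    _ ≤ ∑ w with G.Adj m w, |u w| := Finset.abs_sum_le_sum_abs _ _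
    _ ≤ ∑ w with G.Adj m w, |u m| / f m * f w := Finset.sum_le_sum fun w _ => hle w
    _ = |u m| / f m * ∑ w with G.Adj m w, f w := by rw [Finset.mul_sum]
    _ ≤ |u m| / f m * (c * f m) := by gcongr; exact hc m
    _ = c * |u m| := by field_simp [(hf m).ne']
  exact le_of_mul_le_mul_right h1 hum

theorem index_le_of_sum_le {f : V → ℝ} (hf : ∀ v, 0 < f v) {c : ℝ} (hc0 : 0 ≤ c)
    (hc : ∀ v, ∑ w with G.Adj v w, f w ≤ c * f v) : index G ≤ c := by
  rw [index_eq_sSup]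
  refine Real.sSup_le ?_ hc0
  rintro μ ⟨u, hu0, hu⟩
  exact eigenvalue_le_of_sum_le hf hc hu0 hu

/-- A positive eigenfunction belongs to the largest eigenvalue. -/
theorem index_eq_of_sum_eq [Nonempty V] {f : V → ℝ} (hf : ∀ v, 0 < f v) {c : ℝ}
    (hc : ∀ v, ∑ w with G.Adj v w, f w = c * f v) : index G = c := by
  rw [index_eq_sSup]
  refine IsGreatest.csSup_eq ⟨⟨f, ?_, hc⟩, ?_⟩
  · obtain ⟨v⟩ := ‹Nonempty V›
    exact fun h => (hf v).ne' (congrFun h v)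
  · rintro μ ⟨u, hu0, hu⟩
    exact eigenvalue_le_of_sum_le hf (fun v => (hc v).le) hu0 hu

end Index

/-! ### Adjacency operators of graphs of bounded degree -/

section Operator

variable {V : Type*} {G : SimpleGraph V}

/-- Summing over pairs (vertex, neighbour): each vertex is counted at most `d` times. -/
theorem summable_sigma_neighborSet [∀ v, Fintype (G.neighborSet v)] {d : ℕ}
    (hd : ∀ v, Fintype.card (G.neighborSet v) ≤ d) {a : V → ℝ} (ha0 : ∀ v, 0 ≤ a v)
    (ha : Summable a) :
    Summable (fun p : Σ v, G.neighborSet v => a p.1) ∧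
      ∑' p : Σ v, G.neighborSet v, a p.1 ≤ d * ∑' v, a v := by
  have hle : ∀ v, ∑' _ : G.neighborSet v, a v ≤ d * a v := fun v => by
    rw [tsum_fintype, Finset.sum_const, nsmul_eq_mul, Finset.card_univ]
    gcongr
    · exact ha0 v
    · exact hd v
  have hnn : ∀ v, 0 ≤ ∑' _ : G.neighborSet v, a v := fun v => tsum_nonneg fun _ => ha0 v
  have hs' : Summable fun v => ∑' _ : G.neighborSet v, a v :=
    Summable.of_nonneg_of_le hnn hle (ha.mul_left _)
  have hs : Summable (fun p : Σ v, G.neighborSet v => a p.1) :=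
    (summable_sigma_of_nonneg fun p => ha0 p.1).mpr ⟨fun v => (hasSum_fintype _).summable, hs'⟩
  refine ⟨hs, ?_⟩
  rw [hs.tsum_sigma, ← tsum_mul_left]
  exact hs'.tsum_le_tsum hle (ha.mul_left _)

/-- Reversal of directed edges. -/
def dartSwap (G : SimpleGraph V) : (Σ v, G.neighborSet v) ≃ Σ v, G.neighborSet v where
  toFun p := ⟨p.2.1, p.1, G.adj_symm p.2.2⟩
  invFun p := ⟨p.2.1, p.1, G.adj_symm p.2.2⟩
  left_inv _ := rfl
  right_inv _ := rfl

theorem summable_sum_neighborSet [∀ v, Fintype (G.neighborSet v)] {d : ℕ}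
    (hd : ∀ v, Fintype.card (G.neighborSet v) ≤ d) {a : V → ℝ} (ha0 : ∀ v, 0 ≤ a v)
    (ha : Summable a) :
    Summable (fun v => ∑ w : G.neighborSet v, a w) ∧
      ∑' v, ∑ w : G.neighborSet v, a w ≤ d * ∑' v, a v := by
  obtain ⟨hs, hle⟩ := summable_sigma_neighborSet hd ha0 ha
  have hs2 : Summable (fun p : Σ v, G.neighborSet v => a p.2) :=
    (dartSwap G).summable_iff (f := fun p : Σ v, G.neighborSet v => a p.1) |>.mpr hs
  have heq : ∑' p : Σ v, G.neighborSet v, a p.2 = ∑' p : Σ v, G.neighborSet v, a p.1 :=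
    (dartSwap G).tsum_eq (fun p : Σ v, G.neighborSet v => a p.1)
  have h := ((summable_sigma_of_nonneg fun p : Σ v, G.neighborSet v => ha0 p.2).mp hs2).2
  have h' := hs2.tsum_sigma
  simp only [tsum_fintype] at h h'
  exact ⟨h, by rw [← h', heq]; exact hle⟩

theorem norm_sq_sum_neighborSet_le [∀ v, Fintype (G.neighborSet v)] {d : ℕ}
    (hd : ∀ v, Fintype.card (G.neighborSet v) ≤ d) (f : V → ℂ) (v : V) :
    ‖∑ w : G.neighborSet v, f w‖ ^ 2 ≤ d * ∑ w : G.neighborSet v, ‖f w‖ ^ 2 := calc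
  ‖∑ w : G.neighborSet v, f w‖ ^ 2 ≤ (∑ w : G.neighborSet v, ‖f w‖) ^ 2 := by
    gcongr
    exact norm_sum_le _ _
  _ ≤ Fintype.card (G.neighborSet v) * ∑ w : G.neighborSet v, ‖f w‖ ^ 2 := by
    simpa using sq_sum_le_card_mul_sum_sq (s := Finset.univ)
      (f := fun w : G.neighborSet v => ‖f w‖)
  _ ≤ d * ∑ w : G.neighborSet v, ‖f w‖ ^ 2 := by
    gcongr
    exact hd v

theorem summable_norm_sq (f : lp (fun _ : V => ℂ) 2) : Summable fun v => ‖f v‖ ^ 2 := by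
  simpa using (lp.memℓp f).summable (by norm_num)

theorem norm_sq_eq_tsum_norm_sq (f : lp (fun _ : V => ℂ) 2) : ‖f‖ ^ 2 = ∑' v, ‖f v‖ ^ 2 := by
  simpa using lp.norm_rpow_eq_tsum (p := 2) (by norm_num) f

theorem summable_norm_sq_sum_neighborSet [∀ v, Fintype (G.neighborSet v)] {d : ℕ}
    (hd : ∀ v, Fintype.card (G.neighborSet v) ≤ d) (f : lp (fun _ : V => ℂ) 2) :
    Summable fun v => ‖∑ w : G.neighborSet v, f w‖ ^ 2 :=
  Summable.of_nonneg_of_le (fun _ => by positivity) (norm_sq_sum_neighborSet_le hd f)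
    ((summable_sum_neighborSet hd (fun _ => by positivity) (summable_norm_sq f)).1.mul_left _)

/-- A graph with all degrees at most `d` has an adjacency operator on `ℓ²`; it is self-adjoint and
its norm is at most `d`. -/
theorem exists_isAdjOperator {d : ℕ} (h : ∀ v, (G.neighborSet v).encard ≤ d) :
    ∃ T : lp (fun _ : V => ℂ) 2 →L[ℂ] lp (fun _ : V => ℂ) 2,
      IsAdjOperator G T ∧ IsSelfAdjoint T ∧ ‖T‖ ≤ d := by
  have hfin : ∀ v, (G.neighborSet v).Finite := fun v =>
    Set.finite_of_encard_le_coe (h v)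
  let _ : ∀ v, Fintype (G.neighborSet v) := fun v => (hfin v).fintype
  have hd : ∀ v, Fintype.card (G.neighborSet v) ≤ d := fun v => by
    have := h v
    rwa [Set.encard_eq_coe_toFinset_card, Set.toFinset_card, Nat.cast_le] at this
  let L : lp (fun _ : V => ℂ) 2 →ₗ[ℂ] lp (fun _ : V => ℂ) 2 :=
    { toFun := fun f => ⟨fun v => ∑ w : G.neighborSet v, f w,
        memℓp_gen (by simpa using summable_norm_sq_sum_neighborSet hd f)⟩
      map_add' := fun f g => by
        ext v
        exact Finset.sum_add_distrib
      map_smul' := fun c f => by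
        ext v
        simp [Finset.mul_sum] }
  have hL : ∀ f v, L f v = ∑ w : G.neighborSet v, f w := fun _ _ => rfl
  have hbound : ∀ f, ‖L f‖ ≤ d * ‖f‖ := fun f => by
    refine le_of_sq_le_sq ?_ (by positivity)
    rw [mul_pow, norm_sq_eq_tsum_norm_sq, norm_sq_eq_tsum_norm_sq]
    obtain ⟨hs, hle⟩ := summable_sum_neighborSet hd (fun _ => by positivity) (summable_norm_sq f)
    calc ∑' v, ‖L f v‖ ^ 2 ≤ ∑' v, d * ∑ w : G.neighborSet v, ‖f w‖ ^ 2 :=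
          (summable_norm_sq_sum_neighborSet hd f).tsum_le_tsum (norm_sq_sum_neighborSet_le hd f)
            (hs.mul_left _)
      _ = d * ∑' v, ∑ w : G.neighborSet v, ‖f w‖ ^ 2 := tsum_mul_left
      _ ≤ d * (d * ∑' v, ‖f v‖ ^ 2) := by gcongr
      _ = d ^ 2 * ∑' v, ‖f v‖ ^ 2 := by ring
  refine ⟨L.mkContinuous d hbound, fun f v => ?_, ?_, L.mkContinuous_norm_le (by positivity) _⟩
  · exact hasSum_fintype _
  · rw [ContinuousLinearMap.isSelfAdjoint_iff_isSymmetric]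
    intro f g
    change inner ℂ (L f) g = inner ℂ f (L g)
    -- Both sides are the sum of `⟪f v, g w⟫` over all directed edges `(v, w)`.
    have hsum : Summable fun p : Σ v, G.neighborSet v => inner ℂ (f p.1) (g p.2) := by
      have h1 := (summable_sigma_neighborSet hd (fun _ => by positivity) (summable_norm_sq f)).1
      have h2 := (summable_sigma_neighborSet hd (fun _ => by positivity) (summable_norm_sq g)).1
      rw [← (dartSwap G).summable_iff] at h2
      refine Summable.of_norm_bounded (h1.add h2) fun p => ?_
      refine (norm_inner_le_norm _ _).trans ?_
      simp only [Function.comp, dartSwap, Equiv.coe_fn_mk]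
      nlinarith [sq_nonneg (‖f p.1‖ - ‖g p.2‖), sq_nonneg ‖f p.1‖, sq_nonneg ‖g p.2‖]
    have hsum' : Summable fun p : Σ v, G.neighborSet v => inner ℂ (f p.2) (g p.1) :=
      (dartSwap G).summable_iff.mpr hsum
    have hswap : ∑' p : Σ v, G.neighborSet v, inner ℂ (f p.2) (g p.1) =
        ∑' p : Σ v, G.neighborSet v, inner ℂ (f p.1) (g p.2) :=
      (dartSwap G).tsum_eq fun p : Σ v, G.neighborSet v => inner ℂ (f p.1) (g p.2)
    rw [hsum.tsum_sigma, hsum'.tsum_sigma] at hswap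
    rw [lp.inner_eq_tsum, lp.inner_eq_tsum]
    simpa only [hL, sum_inner, inner_sum, tsum_fintype] using hswap

/-- An eigenvalue of a finite induced subgraph bounds the norm of the adjacency operator from
below: extend the eigenfunction by zero. -/
theorem abs_eigenvalue_le_norm_of_embedding {W : Type*} [Fintype W] {H : SimpleGraph W}
    [DecidableRel H.Adj] (φ : H ↪g G) {T : lp (fun _ : V => ℂ) 2 →L[ℂ] lp (fun _ : V => ℂ) 2}
    (hT : IsAdjOperator G T) {u : W → ℝ} {μ : ℝ} (hu0 : u ≠ 0)
    (hu : ∀ v, ∑ w with H.Adj v w, u w = μ * u v) : |μ| ≤ ‖T‖ := by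
  classical
  let F : V → ℂ := Function.extend φ (fun w => (u w : ℂ)) 0
  have hF : ∀ w, F (φ w) = u w := fun w => φ.injective.extend_apply _ _ _
  let S : Finset V := Finset.univ.map φ.toEmbedding
  have hF0 : ∀ v ∉ S, F v = 0 := fun v hv =>
    Function.extend_apply' _ _ _ fun ⟨w, hw⟩ =>
      hv (Finset.mem_map.mpr ⟨w, Finset.mem_univ _, hw⟩)
  let f : lp (fun _ : V => ℂ) 2 := ⟨F, memℓp_gen (summable_of_ne_finset_zero (s := S)
    fun v hv => by simp [hF0 v hv])⟩
  have hf : ∀ v, f v = F v := fun _ => rfl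
  have hfnorm : ‖f‖ ^ 2 = ∑ w, u w ^ 2 := by
    rw [norm_sq_eq_tsum_norm_sq, tsum_eq_sum (s := S) fun v hv => by simp [hf, hF0 v hv]]
    simp [S, hf, hF]
  have hTf : ∀ w, T f (φ w) = (μ * u w : ℝ) := fun w => by
    let ι : H.neighborSet w → G.neighborSet (φ w) := fun x => ⟨φ x, φ.map_rel_iff.mpr x.2⟩
    have hι : Function.Injective ι := fun x y hxy =>
      Subtype.ext (φ.injective (congrArg Subtype.val hxy))
    have h1 := hT f (φ w)
    rw [← hι.hasSum_iff] at h1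
    · have h2 := h1.unique (hasSum_fintype _)
      rw [h2, ← hu w]
      push_cast
      have h3 : ∀ x : H.neighborSet w, ((fun y : G.neighborSet (φ w) => f y.1) ∘ ι) x = u x :=
        fun x => hF x
      rw [Finset.sum_congr rfl fun x _ => h3 x]
      exact (Finset.sum_subtype _ (by simp) fun x => (u x : ℂ)).symm
    · rintro ⟨v, hv⟩ hvι
      refine hF0 v fun hvS => hvι ?_
      obtain ⟨x, -, rfl⟩ := Finset.mem_map.mp hvS
      exact ⟨⟨x, φ.map_rel_iff.mp hv⟩, rfl⟩
  have hlow : μ ^ 2 * ‖f‖ ^ 2 ≤ ‖T f‖ ^ 2 := by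
    rw [norm_sq_eq_tsum_norm_sq (T f), hfnorm, Finset.mul_sum]
    refine le_trans (le_of_eq ?_) ((summable_norm_sq (T f)).sum_le_tsum S fun _ _ => by positivity)
    rw [Finset.sum_map]
    refine Finset.sum_congr rfl fun w _ => ?_
    change _ = ‖T f (φ w)‖ ^ 2
    rw [hTf, Complex.norm_real, Real.norm_eq_abs, sq_abs, mul_pow]
  have hpos : 0 < ‖f‖ := by
    rw [norm_pos_iff]
    rintro h0
    obtain ⟨w, hw⟩ := Function.ne_iff.mp hu0
    have : f (φ w) = 0 := by rw [h0]; rfl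
    rw [hf, hF] at this
    exact hw (Complex.ofReal_eq_zero.mp this)
  have hle : |μ| * ‖f‖ ≤ ‖T‖ * ‖f‖ := by
    refine le_trans (le_of_sq_le_sq ?_ (norm_nonneg (T f))) (T.le_opNorm f)
    rwa [mul_pow, sq_abs]
  exact le_of_mul_le_mul_right hle hpos

/-- If the degrees are at most `d` and finite induced subgraphs have eigenvalues tending to `d`,
then the spectral radius is `d`. -/
theorem hasSpectralRadius_of_tendsto {d : ℕ} (h : ∀ v, (G.neighborSet v).encard ≤ d)
    {μ : ℕ → ℝ} (hμ : Filter.Tendsto μ Filter.atTop (𝓝 d))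
    (hle : ∀ T, IsAdjOperator G T → ∀ᶠ n in Filter.atTop, μ n ≤ ‖T‖) :
    HasSpectralRadius G d := by
  obtain ⟨T, hT, hsa, hnorm⟩ := exists_isAdjOperator h
  refine ⟨T, hT, ?_⟩
  refine (ContinuousLinearMap.spectralRadius_eq_nnnorm T hsa).trans (congrArg _ ?_)
  exact NNReal.eq (le_antisymm (by simpa using hnorm) (by simpa using le_of_tendsto hμ (hle T hT)))

end Operator

/-! ### Paths -/

theorem pathGraph_sum_adj {n : ℕ} [DecidableRel (SimpleGraph.pathGraph n).Adj] (F : ℤ → ℝ)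
    (i : Fin n) :
    ∑ i' with (SimpleGraph.pathGraph n).Adj i i', F i'.val =
      (if i.val = 0 then 0 else F (i.val - 1)) +
        (if i.val + 1 = n then 0 else F (i.val + 1)) := by
  have hi := i.2
  have hsplit : (Finset.univ.filter fun i' => (SimpleGraph.pathGraph n).Adj i i') =
      (Finset.univ.filter fun i' : Fin n => i'.val + 1 = i.val) ∪
        (Finset.univ.filter fun i' : Fin n => i.val + 1 = i'.val) := by
    ext i'
    simp only [Finset.mem_filter, Finset.mem_univ, true_and, Finset.mem_union,
      SimpleGraph.pathGraph_adj]
    exact or_comm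
  have hdisj : Disjoint (Finset.univ.filter fun i' : Fin n => i'.val + 1 = i.val)
      (Finset.univ.filter fun i' : Fin n => i.val + 1 = i'.val) := by
    rw [Finset.disjoint_filter]
    intro i' _ h1 h2
    omega
  rw [hsplit, Finset.sum_union hdisj]
  congr 1
  · split_ifs with h
    · refine Finset.sum_eq_zero fun i' hi' => ?_
      have := (Finset.mem_filter.mp hi').2
      omega
    · rw [Finset.sum_eq_single_of_mem (⟨i.val - 1, by omega⟩ : Fin n)]
      · congr 1
        dsimp only
        omega
      · simp only [Finset.mem_filter, Finset.mem_univ, true_and]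
        omega
      · intro i' hi' hne
        have := (Finset.mem_filter.mp hi').2
        exact absurd (Fin.ext (by dsimp only; omega)) hne
  · split_ifs with h
    · refine Finset.sum_eq_zero fun i' hi' => ?_
      have := (Finset.mem_filter.mp hi').2
      have := i'.2
      omega
    · rw [Finset.sum_eq_single_of_mem (⟨i.val + 1, by omega⟩ : Fin n)]
      · congr 1
      · simp
      · intro i' hi' hne
        have := (Finset.mem_filter.mp hi').2
        exact absurd (Fin.ext (by dsimp only; omega)) hne

/-- The two-particle function `sin a sin b |cos a - cos b|`, where `a = tk` and `b = tl`. For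
`0 ≤ a ≤ b ≤ π` the absolute value can be dropped, which leaves
`(sin 2a sin b - sin a sin 2b) / 2`, the Slater determinant (up to a factor) of `sin (t ·)` and
`sin (2t ·)`. These are one-particle eigenfunctions on the path when `t = π / (n + 1)`. -/
noncomputable def slater (t : ℝ) (k l : ℤ) : ℝ :=
  Real.sin (t * k) * Real.sin (t * l) * |Real.cos (t * k) - Real.cos (t * l)|

theorem slater_comm (t : ℝ) (k l : ℤ) : slater t k l = slater t l k := by
  unfold slater
  rw [abs_sub_comm]
  ring

theorem slater_self (t : ℝ) (k : ℤ) : slater t k k = 0 := by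
  simp [slater]

theorem slater_of_le {t : ℝ} (ht : 0 ≤ t) {k l : ℤ} (hk : 0 ≤ k) (hkl : k ≤ l)
    (hl : t * l ≤ Real.pi) :
    slater t k l =
      Real.sin (t * k) * Real.sin (t * l) * (Real.cos (t * k) - Real.cos (t * l)) := by
  have hk' : (0 : ℝ) ≤ k := by exact_mod_cast hk
  have hkl' : (k : ℝ) ≤ l := by exact_mod_cast hkl
  rw [slater, abs_of_nonneg]
  rw [sub_nonneg]
  exact Real.cos_le_cos_of_nonneg_of_le_pi (by positivity) hl (by gcongr)

theorem slater_pos {t : ℝ} (ht : 0 < t) {k l : ℤ} (hk : 0 < k) (hkl : k < l)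
    (hl : t * l < Real.pi) : 0 < slater t k l := by
  rw [slater_of_le ht.le hk.le hkl.le hl.le]
  have hk' : (0 : ℝ) < k := by exact_mod_cast hk
  have hkl' : (k : ℝ) < l := by exact_mod_cast hkl
  have hlt : t * k < t * l := by gcongr
  refine mul_pos (mul_pos ?_ ?_) ?_
  · exact Real.sin_pos_of_pos_of_lt_pi (by positivity) (hlt.trans hl)
  · exact Real.sin_pos_of_pos_of_lt_pi (mul_pos ht (hk'.trans hkl')) hl
  · rw [sub_pos]
    exact Real.cos_lt_cos_of_nonneg_of_le_pi (by positivity) hl.le hlt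

/-- The one-particle eigenvalues `2 cos t` and `2 cos 2t` add up. The absolute value
in `slater` does not interfere, since the positions stay weakly ordered after a single move. -/
theorem slater_sum {t : ℝ} (ht : 0 ≤ t) {k l : ℤ} (hk : 0 < k) (hkl : k < l)
    (hl : t * (l + 1 : ℤ) ≤ Real.pi) :
    (slater t (k - 1) l + slater t (k + 1) l) + (slater t k (l - 1) + slater t k (l + 1)) =
      (2 * Real.cos t + 2 * Real.cos (2 * t)) * slater t k l := by
  have hle : ∀ m : ℤ, m ≤ l + 1 → t * m ≤ Real.pi := fun m hm =>
    (mul_le_mul_of_nonneg_left (by exact_mod_cast hm) ht).trans hl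
  have e1 : ∀ a : ℝ, Real.sin (a - t) + Real.sin (a + t) = 2 * Real.cos t * Real.sin a :=
    fun a => by rw [Real.sin_sub, Real.sin_add]; ring
  have e2 : ∀ a : ℝ, Real.sin (a - t) * Real.cos (a - t) + Real.sin (a + t) * Real.cos (a + t) =
      2 * Real.cos (2 * t) * (Real.sin a * Real.cos a) := fun a => by
    have h1 := Real.sin_two_mul (a - t)
    have h2 := Real.sin_two_mul (a + t)
    have h3 := Real.sin_two_mul a
    rw [mul_sub, Real.sin_sub] at h1
    rw [mul_add, Real.sin_add] at h2
    linear_combination -h1 / 2 - h2 / 2 + Real.cos (2 * t) * h3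
  rw [slater_of_le ht (by omega) (by omega) (hle l (by omega)),
    slater_of_le ht (by omega) (by omega) (hle l (by omega)),
    slater_of_le ht (by omega) (by omega) (hle (l - 1) (by omega)),
    slater_of_le ht (by omega) (by omega) hl,
    slater_of_le ht (by omega) (by omega) (hle l (by omega))]
  push_cast
  simp only [mul_sub, mul_add, mul_one]
  generalize t * (k : ℝ) = a
  generalize t * (l : ℝ) = b
  linear_combination Real.sin b * e2 a - Real.sin b * Real.cos b * e1 a +
    Real.sin a * Real.cos a * e1 b - Real.sin a * e2 b

/-- The two-token graph of a path has a positive eigenfunction, with the sum of the two largest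
eigenvalues of the path as its eigenvalue. -/
theorem exists_pos_eigenfunction_tokenGraph_pathGraph (n : ℕ)
    [DecidableRel (tokenGraph 2 (SimpleGraph.pathGraph n)).Adj] :
    ∃ u : Vertex (Fin n) 2 → ℝ, (∀ A, 0 < u A) ∧
      ∀ A, ∑ B with (tokenGraph 2 (SimpleGraph.pathGraph n)).Adj A B, u B =
        (2 * Real.cos (Real.pi / (n + 1)) + 2 * Real.cos (2 * (Real.pi / (n + 1)))) * u A := by
  classical
  set t : ℝ := Real.pi / (n + 1) with ht_def
  have ht : 0 < t := by positivity
  have htn : t * (n + 1) = Real.pi := div_mul_cancel₀ _ (by positivity)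
  let g : Fin n → Fin n → ℝ := fun i j => slater t (i.val + 1) (j.val + 1)
  have hg : ∀ i j, g i j = g j i := fun i j => slater_comm _ _ _
  have hg0 : ∀ i, g i i = 0 := fun i => slater_self _ _
  have hpair : ∀ A : Vertex (Fin n) 2, ∃ i j, i < j ∧ A.1 = {i, j} := fun A => by
    obtain ⟨i, j, hij, hA⟩ := A.exists_eq_pair
    rcases lt_or_gt_of_ne hij with h | h
    · exact ⟨i, j, h, hA⟩
    · exact ⟨j, i, h, hA.trans (Finset.pair_comm _ _)⟩
  refine ⟨pairFun g, fun A => ?_, fun A => ?_⟩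
  · obtain ⟨i, j, hij, hA⟩ := hpair A
    rw [pairFun_eq hg hg0 hij.ne hA]
    refine slater_pos ht (by omega) (by simpa using hij) ?_
    rw [← htn]
    gcongr
    have := j.2
    exact_mod_cast (by omega : (j.val : ℤ) + 1 < n + 1)
  · obtain ⟨i, j, hij, hA⟩ := hpair A
    rw [sum_adj_pairFun hg hg0 hij.ne hA, pairFun_eq hg hg0 hij.ne hA]
    -- The eigenfunction vanishes at the positions `0` and `n + 1` beyond the ends of the path.
    have hz0 : ∀ l, slater t 0 l = 0 := fun l => by simp [slater]
    have hzn : ∀ l, slater t (n + 1) l = 0 := fun l => by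
      simp [slater, htn]
    have hmove : ∀ (i : Fin n) (l : ℤ), ∑ i' with (SimpleGraph.pathGraph n).Adj i i',
        slater t (i'.val + 1) l =
          slater t ((i.val + 1 : ℤ) - 1) l + slater t ((i.val + 1 : ℤ) + 1) l := fun i l => by
      rw [pathGraph_sum_adj (fun x => slater t (x + 1) l) i]
      congr 1
      · split_ifs with h
        · simp [h, hz0]
        · congr 1
          ring
      · split_ifs with h
        · have : (i.val + 1 : ℤ) = n := by exact_mod_cast h
          rw [this, hzn]
        · rfl
    simp only [g]
    rw [hmove, Finset.sum_congr rfl fun j' _ => slater_comm t (i.val + 1) (j'.val + 1), hmove,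
      slater_comm _ _ (i.val + 1 : ℤ), slater_comm _ _ (i.val + 1 : ℤ)]
    refine slater_sum ht.le (by omega) (by simpa using hij) ?_
    rw [← htn]
    gcongr
    have := j.2
    exact_mod_cast (by omega : (j.val : ℤ) + 1 + 1 ≤ n + 1)

theorem vertex_nonempty {n : ℕ} (hn : 2 ≤ n) : Nonempty (Vertex (Fin n) 2) :=
  ⟨⟨{⟨0, by omega⟩, ⟨1, by omega⟩}, Finset.card_pair fun h => by simpa using congrArg Fin.val h⟩⟩

theorem index_tokenGraph_pathGraph {n : ℕ} (hn : 2 ≤ n) :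
    index (tokenGraph 2 (SimpleGraph.pathGraph n)) =
      2 * Real.cos (Real.pi / (n + 1)) + 2 * Real.cos (2 * (Real.pi / (n + 1))) := by
  classical
  have := vertex_nonempty hn
  obtain ⟨u, hpos, hu⟩ := exists_pos_eigenfunction_tokenGraph_pathGraph n
  exact index_eq_of_sum_eq hpos hu

theorem tendsto_two_cos_add_two_cos :
    Filter.Tendsto (fun n : ℕ =>
      2 * Real.cos (Real.pi / (n + 1)) + 2 * Real.cos (2 * (Real.pi / (n + 1))))
      Filter.atTop (𝓝 4) := by
  have h0 : Filter.Tendsto (fun n : ℕ => Real.pi / ((n : ℝ) + 1)) Filter.atTop (𝓝 0) := by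
    have := (Filter.tendsto_add_atTop_iff_nat 1).mpr
      (tendsto_const_div_atTop_nhds_zero_nat Real.pi)
    simpa using this
  have hcont : Continuous fun x : ℝ => 2 * Real.cos x + 2 * Real.cos (2 * x) := by fun_prop
  have h := (hcont.tendsto 0).comp h0
  have h4 : 2 * Real.cos 0 + 2 * Real.cos (2 * 0) = 4 := by
    rw [mul_zero, Real.cos_zero]
    norm_num
  rw [h4] at h
  exact h

/-! ### The sine of the distance on a cycle -/

theorem abs_sin_pos {n : ℕ} {d : ℤ} (hd0 : d ≠ 0) (hd : |d| < n) :
    0 < |Real.sin (Real.pi * d / n)| := by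
  have hn : (0 : ℝ) < n := by
    have := abs_nonneg d
    exact_mod_cast (by omega : (0 : ℤ) < n)
  rw [abs_pos]
  have hd' := abs_lt.mp hd
  have h1 : -(n : ℝ) < d := by exact_mod_cast hd'.1
  have h2 : (d : ℝ) < n := by exact_mod_cast hd'.2
  have hdne : (d : ℝ) ≠ 0 := by exact_mod_cast hd0
  rw [Ne, Real.sin_eq_zero_iff_of_lt_of_lt]
  · positivity
  · rw [lt_div_iff₀ hn]
    nlinarith [Real.pi_pos]
  · rw [div_lt_iff₀ hn]
    nlinarith [Real.pi_pos]

theorem abs_sin_sub_one_add_abs_sin_add_one {n : ℕ} {d : ℤ} (hd0 : d ≠ 0) (hd : |d| < n) :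
    |Real.sin (Real.pi * (d - 1) / n)| + |Real.sin (Real.pi * (d + 1) / n)| =
      2 * Real.cos (Real.pi / n) * |Real.sin (Real.pi * d / n)| := by
  have hn : (0 : ℝ) < n := by
    have := abs_nonneg d
    exact_mod_cast (by omega : (0 : ℤ) < n)
  have key : ∀ d : ℤ, 0 < d → d < n →
      |Real.sin (Real.pi * (d - 1) / n)| + |Real.sin (Real.pi * (d + 1) / n)| =
        2 * Real.cos (Real.pi / n) * |Real.sin (Real.pi * d / n)| := fun d hd0 hd => by
    have hnn : ∀ x : ℤ, 0 ≤ x → x ≤ n → 0 ≤ Real.sin (Real.pi * x / n) := fun x h1 h2 => by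
      have h1' : (0 : ℝ) ≤ x := by exact_mod_cast h1
      have h2' : (x : ℝ) ≤ n := by exact_mod_cast h2
      refine Real.sin_nonneg_of_nonneg_of_le_pi (by positivity) ?_
      rw [div_le_iff₀ hn]
      gcongr
    have a1 := hnn (d - 1) (by omega) (by omega)
    have a2 := hnn (d + 1) (by omega) (by omega)
    have a3 := hnn d (by omega) (by omega)
    push_cast at a1 a2
    rw [abs_of_nonneg a1, abs_of_nonneg a2, abs_of_nonneg a3]
    have e1 : Real.pi * ((d : ℝ) - 1) / n = Real.pi * d / n - Real.pi / n := by ring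
    have e2 : Real.pi * ((d : ℝ) + 1) / n = Real.pi * d / n + Real.pi / n := by ring
    rw [e1, e2, Real.sin_sub, Real.sin_add]
    ring
  rcases lt_or_gt_of_ne hd0 with h | h
  · have h' := key (-d) (by omega) (by have := (abs_lt.mp hd).1; omega)
    push_cast at h'
    have e1 : Real.pi * (-(d : ℝ) - 1) / n = -(Real.pi * (d + 1) / n) := by ring
    have e2 : Real.pi * (-(d : ℝ) + 1) / n = -(Real.pi * (d - 1) / n) := by ring
    have e3 : Real.pi * -(d : ℝ) / n = -(Real.pi * d / n) := by ring
    rw [e1, e2, e3, Real.sin_neg, Real.sin_neg, Real.sin_neg, abs_neg, abs_neg, abs_neg] at h'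
    rw [add_comm]
    exact h'
  · exact key d h (lt_of_abs_lt hd)

/-- The function `(i, j) ↦ |sin (π (i - j) / n)|`, which depends only on the distance of `i` and
`j` on the cycle of length `n`. -/
noncomputable def sinDist (n : ℕ) (i j : ℤ) : ℝ := |Real.sin (Real.pi * (i - j) / n)|

theorem sinDist_comm (n : ℕ) (i j : ℤ) : sinDist n i j = sinDist n j i := by
  unfold sinDist
  rw [← abs_neg, ← Real.sin_neg]
  congr 2
  ring

theorem sinDist_self (n : ℕ) (i : ℤ) : sinDist n i i = 0 := by
  simp [sinDist]

theorem sinDist_pos {n : ℕ} {i j : Fin n} (hij : i ≠ j) : 0 < sinDist n i.val j.val := by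
  have hi := i.2
  have hj := j.2
  have hne := Fin.val_ne_of_ne hij
  have := abs_sin_pos (n := n) (d := (i.val : ℤ) - j.val) (by omega) (by rw [abs_lt]; omega)
  push_cast at this
  simpa [sinDist] using this

theorem sinDist_sub_one_add {n : ℕ} {i j : Fin n} (hij : i ≠ j) :
    sinDist n (i.val - 1) j.val + sinDist n (i.val + 1) j.val =
      2 * Real.cos (Real.pi / n) * sinDist n i.val j.val := by
  have hi := i.2
  have hj := j.2
  have hne := Fin.val_ne_of_ne hij
  have := abs_sin_sub_one_add_abs_sin_add_one (n := n) (d := (i.val : ℤ) - j.val) (by omega)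
    (by rw [abs_lt]; omega)
  push_cast at this
  simp only [sinDist]
  push_cast
  rw [← this]
  congr 4 <;> ring

theorem sinDist_periodic {n : ℕ} (hn : n ≠ 0) (j : ℤ) :
    Function.Periodic (fun i => sinDist n i j) (n : ℤ) := fun i => by
  have hn' : (n : ℝ) ≠ 0 := by exact_mod_cast hn
  simp only [sinDist]
  push_cast
  rw [show Real.pi * ((i : ℝ) + n - j) / n = Real.pi * (i - j) / n + Real.pi by field_simp; ring,
    Real.sin_add_pi, abs_neg]

theorem pathGraph_sum_sinDist_le {n : ℕ} [DecidableRel (SimpleGraph.pathGraph n).Adj]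
    {i j : Fin n} (hij : i ≠ j) :
    ∑ i' with (SimpleGraph.pathGraph n).Adj i i', sinDist n i'.val j.val ≤
      2 * Real.cos (Real.pi / n) * sinDist n i.val j.val := by
  rw [pathGraph_sum_adj (fun x => sinDist n x j.val) i, ← sinDist_sub_one_add hij]
  have hnn : ∀ x y, 0 ≤ sinDist n x y := fun _ _ => abs_nonneg _
  gcongr
  · split_ifs
    · exact hnn _ _
    · exact le_rfl
  · split_ifs
    · exact hnn _ _
    · exact le_rfl

theorem index_tokenGraph_pathGraph_le {n : ℕ} (hn : 2 ≤ n) :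
    index (tokenGraph 2 (SimpleGraph.pathGraph n)) ≤ 4 * Real.cos (Real.pi / n) := by
  classical
  let g : Fin n → Fin n → ℝ := fun i j => sinDist n i.val j.val
  have hg : ∀ i j, g i j = g j i := fun i j => sinDist_comm _ _ _
  have hg0 : ∀ i, g i i = 0 := fun i => sinDist_self _ _
  have hcos : 0 ≤ Real.cos (Real.pi / n) := by
    refine Real.cos_nonneg_of_neg_pi_div_two_le_of_le ?_ ?_
    · linarith [Real.pi_pos, show 0 ≤ Real.pi / n by positivity]
    · gcongr
      exact_mod_cast hn
  refine index_le_of_sum_le (f := pairFun g) (fun A => ?_) (by positivity) fun A => ?_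
  · obtain ⟨i, j, hij, hA⟩ := A.exists_eq_pair
    rw [pairFun_eq hg hg0 hij hA]
    exact sinDist_pos hij
  · obtain ⟨i, j, hij, hA⟩ := A.exists_eq_pair
    rw [sum_adj_pairFun hg hg0 hij hA, pairFun_eq hg hg0 hij hA,
      Finset.sum_congr rfl fun j' _ => hg i j']
    have h1 := pathGraph_sum_sinDist_le hij
    have h2 := pathGraph_sum_sinDist_le hij.symm
    rw [sinDist_comm n j.val i.val] at h2
    simp only [g]
    linarith

/-! ### Cycles -/

theorem cycleGraph_sum_adj {n : ℕ} (hn : 3 ≤ n) {F : ℤ → ℝ} (hF : Function.Periodic F (n : ℤ))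
    (i : Fin n) :
    ∑ i' with (SimpleGraph.cycleGraph n).Adj i i', F i'.val =
      F (i.val - 1) + F (i.val + 1) := by
  obtain ⟨m, rfl⟩ := Nat.exists_eq_add_of_le' hn
  have hne : i - 1 ≠ i + 1 := fun h => by
    have h2 := SimpleGraph.cycleGraph_degree_three_le (v := i)
    rw [SimpleGraph.cycleGraph_degree_two_le, h] at h2
    simp at h2
  have hfilter : (Finset.univ.filter fun i' => (SimpleGraph.cycleGraph (m + 3)).Adj i i') =
      {i - 1, i + 1} := by
    rw [← SimpleGraph.neighborFinset_eq_filter, SimpleGraph.cycleGraph_neighborFinset]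
  -- Addition in `Fin` wraps around, which a periodic function does not notice.
  have hmod : ∀ x : ℤ, F (x % (m + 3 : ℕ)) = F x := fun x => by
    rw [Int.emod_def, mul_comm]
    exact hF.sub_int_mul_eq (x / (m + 3 : ℕ))
  rw [hfilter, Finset.sum_pair hne]
  congr 1
  · rw [Fin.val_sub, ← hF (i.val - 1), ← hmod (_ + _)]
    congr 1
    push_cast
    congr 1
    have : (1 : Fin (m + 3)).val = 1 := rfl
    rw [this]
    omega
  · rw [Fin.val_add, ← hmod (i.val + 1)]
    congr 1

theorem index_tokenGraph_cycleGraph {n : ℕ} (hn : 3 ≤ n) :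
    index (tokenGraph 2 (SimpleGraph.cycleGraph n)) = 4 * Real.cos (Real.pi / n) := by
  classical
  let g : Fin n → Fin n → ℝ := fun i j => sinDist n i.val j.val
  have hg : ∀ i j, g i j = g j i := fun i j => sinDist_comm _ _ _
  have hg0 : ∀ i, g i i = 0 := fun i => sinDist_self _ _
  have hmove : ∀ i j : Fin n, i ≠ j →
      ∑ i' with (SimpleGraph.cycleGraph n).Adj i i', sinDist n i'.val j.val =
        2 * Real.cos (Real.pi / n) * sinDist n i.val j.val := fun i j hij => by
    rw [cycleGraph_sum_adj hn (sinDist_periodic (by omega) j.val), sinDist_sub_one_add hij]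
  have := vertex_nonempty (show 2 ≤ n by omega)
  refine index_eq_of_sum_eq (f := pairFun g) (fun A => ?_) fun A => ?_
  · obtain ⟨i, j, hij, hA⟩ := A.exists_eq_pair
    rw [pairFun_eq hg hg0 hij hA]
    exact sinDist_pos hij
  · obtain ⟨i, j, hij, hA⟩ := A.exists_eq_pair
    rw [sum_adj_pairFun hg hg0 hij hA, pairFun_eq hg hg0 hij hA,
      Finset.sum_congr rfl fun j' _ => hg i j']
    have h1 := hmove i j hij
    have h2 := hmove j i hij.symm
    rw [sinDist_comm n j.val i.val] at h2
    simp only [g]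
    linarith

theorem tendsto_four_cos :
    Filter.Tendsto (fun n : ℕ => 4 * Real.cos (Real.pi / n)) Filter.atTop (𝓝 4) := by
  have hcont : Continuous fun x : ℝ => 4 * Real.cos x := by fun_prop
  have h := (hcont.tendsto 0).comp (tendsto_const_div_atTop_nhds_zero_nat Real.pi)
  have h4 : 4 * Real.cos 0 = 4 := by rw [Real.cos_zero, mul_one]
  rw [h4] at h
  exact h

/-! ### The infinite path and the infinite cycle -/

theorem encard_pair_le_two {α : Type*} (a b : α) : ({a, b} : Set α).encard ≤ 2 := by
  refine (Set.encard_insert_le _ _).trans (le_of_eq ?_)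
  rw [Set.encard_singleton]
  norm_num

/-- A graph of maximum degree two containing all finite paths as induced subgraphs has a `2`-token
graph of spectral radius `4`. -/
theorem hasSpectralRadius_tokenGraph_two {V : Type*} [DecidableEq V] {G : SimpleGraph V}
    (hdeg : ∀ v, (G.neighborSet v).encard ≤ 2) (φ : ∀ n, SimpleGraph.pathGraph n ↪g G) :
    HasSpectralRadius (tokenGraph 2 G) 4 := by
  classical
  have hdeg' : ∀ A, ((tokenGraph 2 G).neighborSet A).encard ≤ (4 : ℕ) := fun A => by
    refine (encard_neighborSet_tokenGraph_two_le hdeg A).trans (le_of_eq ?_)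
    norm_num
  refine hasSpectralRadius_of_tendsto (d := 4) hdeg'
    (μ := fun n =>
      2 * Real.cos (Real.pi / (n + 1)) + 2 * Real.cos (2 * (Real.pi / (n + 1))))
    (by simpa using tendsto_two_cos_add_two_cos) fun T hT => ?_
  filter_upwards [Filter.eventually_ge_atTop 2] with n hn
  obtain ⟨A⟩ := vertex_nonempty hn
  obtain ⟨u, hpos, hu⟩ := exists_pos_eigenfunction_tokenGraph_pathGraph n
  exact (le_abs_self _).trans (abs_eigenvalue_le_norm_of_embedding
    (tokenGraphEmbedding 2 (φ n)) hT (fun h => (hpos A).ne' (congrFun h A)) hu)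

theorem hasSpectralRadius_tokenGraph_infinitePathGraph :
    HasSpectralRadius (tokenGraph 2 infinitePathGraph) 4 := by
  refine hasSpectralRadius_tokenGraph_two (fun v => ?_) fun n =>
    { toFun := Fin.val, inj' := Fin.val_injective, map_rel_iff' := ?_ }
  · refine le_trans (Set.encard_le_encard (t := {v - 1, v + 1}) fun w hw => ?_)
      (encard_pair_le_two _ _)
    have hw' : v ⋖ w ∨ w ⋖ v := hw
    simp only [Nat.covBy_iff_add_one_eq] at hw'
    simp only [Set.mem_insert_iff, Set.mem_singleton_iff]
    omega
  · intro a b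
    change (a.val ⋖ b.val ∨ b.val ⋖ a.val) ↔ _
    simp [SimpleGraph.pathGraph_adj, Nat.covBy_iff_add_one_eq]

theorem hasSpectralRadius_tokenGraph_infiniteCycleGraph :
    HasSpectralRadius (tokenGraph 2 infiniteCycleGraph) 4 := by
  refine hasSpectralRadius_tokenGraph_two (fun v => ?_) fun n =>
    { toFun := fun i => (i.val : ℤ), inj' := fun i j h => Fin.ext (Int.ofNat_injective h),
      map_rel_iff' := ?_ }
  · refine le_trans (Set.encard_le_encard (t := {v - 1, v + 1}) fun w hw => ?_)
      (encard_pair_le_two _ _)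
    simp only [infiniteCycleGraph, SimpleGraph.mem_neighborSet, SimpleGraph.circulantGraph_adj,
      Set.mem_singleton_iff] at hw
    simp only [Set.mem_insert_iff, Set.mem_singleton_iff]
    omega
  · intro a b
    change infiniteCycleGraph.Adj (a.val : ℤ) (b.val : ℤ) ↔ _
    simp only [infiniteCycleGraph, SimpleGraph.circulantGraph_adj, Set.mem_singleton_iff,
      SimpleGraph.pathGraph_adj]
    omega

/-! ### Complete bipartite graphs -/

/-- The partition of the `2`-subsets into those inside one part and those meeting both parts is
equitable: it reduces the eigenvalue problem to two equations. -/
theorem index_tokenGraph_completeBipartiteGraph_of_eq {n : ℕ} (hn : 1 ≤ n) {α β c : ℝ}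
    (hα : 0 < α) (hβ : 0 < β) (hsame : 2 ≤ n → 2 * (n * β) = c * α)
    (hmixed : 2 * ((n - 1) * α) = c * β) :
    index (tokenGraph 2 (completeBipartiteGraph (Fin n) (Fin n))) = c := by
  classical
  let g : Fin n ⊕ Fin n → Fin n ⊕ Fin n → ℝ := fun x y =>
    if x = y then 0 else if x.isLeft = y.isLeft then α else β
  have hg : ∀ x y, g x y = g y x := fun x y => by
    simp only [g, eq_comm]
  have hg0 : ∀ x, g x x = 0 := fun x => if_pos rfl
  have hmove : ∀ x y, x ≠ y →
      ∑ x' with (completeBipartiteGraph (Fin n) (Fin n)).Adj x x', g x' y =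
        if x.isLeft = y.isLeft then n * β else (n - 1) * α := by
    have hcount : ∀ b : Fin n, ∑ a : Fin n, (if a = b then 0 else α) = (n - 1) * α := fun b => by
      rw [Finset.sum_ite, Finset.sum_const_zero, zero_add, Finset.sum_const, nsmul_eq_mul,
        Finset.filter_ne', Finset.card_erase_of_mem (Finset.mem_univ b), Finset.card_univ,
        Fintype.card_fin, Nat.cast_sub hn, Nat.cast_one]
    rintro (a | a) (b | b) - <;>
      simp [Finset.sum_filter, Fintype.sum_sum_type, g, completeBipartiteGraph, hcount]
  have : Nonempty (Vertex (Fin n ⊕ Fin n) 2) :=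
    ⟨⟨{Sum.inl ⟨0, hn⟩, Sum.inr ⟨0, hn⟩}, Finset.card_pair (by simp)⟩⟩
  refine index_eq_of_sum_eq (f := pairFun g) (fun A => ?_) fun A => ?_
  · obtain ⟨x, y, hxy, hA⟩ := A.exists_eq_pair
    rw [pairFun_eq hg hg0 hxy hA]
    simp only [g, if_neg hxy]
    split_ifs <;> assumption
  · obtain ⟨x, y, hxy, hA⟩ := A.exists_eq_pair
    rw [sum_adj_pairFun hg hg0 hxy hA, pairFun_eq hg hg0 hxy hA,
      Finset.sum_congr rfl fun y' _ => hg x y', hmove x y hxy, hmove y x hxy.symm]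
    simp only [g, if_neg hxy, eq_comm (a := y.isLeft)]
    split_ifs with h
    · -- Two distinct vertices in the same part exist only for `n ≥ 2`.
      have hn2 : 2 ≤ n := by
        by_contra hlt
        have : Subsingleton (Fin n) := Fin.subsingleton_iff_le_one.mpr (by omega)
        rcases x with a | a <;> rcases y with b | b <;> simp at h hxy
        · exact hxy (Subsingleton.elim _ _)
        · exact hxy (Subsingleton.elim _ _)
      linarith [hsame hn2]
    · linarith

theorem index_tokenGraph_completeBipartiteGraph {n : ℕ} (hn : 1 ≤ n) :
    index (tokenGraph 2 (completeBipartiteGraph (Fin n) (Fin n))) =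
      2 * Real.sqrt ((n : ℝ) * ((n : ℝ) - 1)) := by
  rcases hn.eq_or_lt with rfl | hn2
  · exact index_tokenGraph_completeBipartiteGraph_of_eq le_rfl one_pos one_pos (by omega) (by simp)
  · have h1 : (1 : ℝ) < n := by exact_mod_cast hn2
    have h0 : (0 : ℝ) ≤ n := by positivity
    have h2 : (0 : ℝ) < (n : ℝ) - 1 := by linarith
    rw [Real.sqrt_mul h0]
    have e1 := Real.mul_self_sqrt h0
    have e2 := Real.mul_self_sqrt h2.le
    refine index_tokenGraph_completeBipartiteGraph_of_eq hn (α := √(n : ℝ))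
      (β := √((n : ℝ) - 1)) (Real.sqrt_pos.mpr (by linarith)) (Real.sqrt_pos.mpr h2)
      (fun _ => ?_) ?_
    · linear_combination -2 * √((n : ℝ) - 1) * e1
    · linear_combination -2 * √(n : ℝ) * e2

end TokenGraph

theorem mainTheorem5 :
    -- (i) paths
    ((∀ n : ℕ, 2 ≤ n →
        TokenGraph.index (TokenGraph.tokenGraph 2 (SimpleGraph.pathGraph n))
          ≤ 4 * Real.cos (Real.pi / n)) ∧
      TokenGraph.HasSpectralRadius
        (TokenGraph.tokenGraph 2 TokenGraph.infinitePathGraph) 4 ∧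
      Filter.Tendsto
        (fun n : ℕ => TokenGraph.index (TokenGraph.tokenGraph 2 (SimpleGraph.pathGraph n)))
        Filter.atTop (𝓝 4)) ∧
    -- (ii) cycles
    ((∀ n : ℕ, 3 ≤ n →
        TokenGraph.index (TokenGraph.tokenGraph 2 (SimpleGraph.cycleGraph n))
          = 4 * Real.cos (Real.pi / n)) ∧
      TokenGraph.HasSpectralRadius
        (TokenGraph.tokenGraph 2 TokenGraph.infiniteCycleGraph) 4 ∧
      Filter.Tendsto
        (fun n : ℕ => TokenGraph.index (TokenGraph.tokenGraph 2 (SimpleGraph.cycleGraph n)))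
        Filter.atTop (𝓝 4)) ∧
    -- (iii) complete bipartite graphs
    (∀ n : ℕ, 1 ≤ n →
      TokenGraph.index (TokenGraph.tokenGraph 2 (completeBipartiteGraph (Fin n) (Fin n)))
        = 2 * Real.sqrt ((n : ℝ) * ((n : ℝ) - 1))) := by
  refine ⟨⟨fun n hn => TokenGraph.index_tokenGraph_pathGraph_le hn,
    TokenGraph.hasSpectralRadius_tokenGraph_infinitePathGraph, ?_⟩,
    ⟨fun n hn => TokenGraph.index_tokenGraph_cycleGraph hn,
      TokenGraph.hasSpectralRadius_tokenGraph_infiniteCycleGraph, ?_⟩,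
    fun n hn => TokenGraph.index_tokenGraph_completeBipartiteGraph hn⟩
  · refine TokenGraph.tendsto_two_cos_add_two_cos.congr' ?_
    filter_upwards [Filter.eventually_ge_atTop 2] with n hn
    exact (TokenGraph.index_tokenGraph_pathGraph hn).symm
  · refine TokenGraph.tendsto_four_cos.congr' ?_
    filter_upwards [Filter.eventually_ge_atTop 3] with n hn
    exact (TokenGraph.index_tokenGraph_cycleGraph hn).symm
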